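/- Fix $d$. Let $B_R\subset\mathbb R^d$ be the open ball of radius $R$ centred at $0$. There are constants $C,\Lambda,K>0$ depending only on $d$, and for every $c>0$ there is $\delta>0$ depending only on $d$ and $c$, such that the following holds. Let $\alpha\in(0,1]$, $\varepsilon\in(0,1]$, and let $\lambda,\mu$ be finite Borel measures on $\mathbb R^d$ of equal mass that are absolutely continuous with respect to Lebesgue measure. Put $P=\lambda\otimes\mu$, and let $\pi$ be a minimiser, with finite value, of the entropically regularised transport functional $$\pi'\mapsto\int|x-y|^2\,\mathrm d\pi'+\varepsilon^2\int h\Big(\frac{\mathrm d\pi'}{\mathrm dP}\Big)\,\mathrm dP,\qquad h(z)=z\log z,$$ among all couplings $\pi'$ of $\lambda$ and $\mu$ (the functional being $+\infty$ unless $\pi'\ll P$). Let $R\ge C\varepsilon$, and suppose that $\lambda$ and $\mu$ have $C^{0,\alpha}$ densities on $B_{2R}$ (again denoted $\lambda$, $\mu$) with $\lambda,\mu\ge c$ on $B_R$. Set $$E(\pi,2R)=\frac1{(2R)^{d+2}}\int_{B_{2R}\times\mathbb R^d}|x-y|^2\,\mathrm d\pi,\qquad D(2R)=(2R)^{2\alpha}\big([\lambda]_{\alpha,2R}^2+[\mu]_{\alpha,2R}^2\big),$$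 where $[\cdot]_{\alpha,2R}$ is the $\alpha$-Hölder seminorm on $B_{2R}$. If $E(\pi,2R)+D(2R)\le\delta$, then for almost every $x\in B_R$ the function $y\mapsto|x-y|^2\frac{\mathrm d\pi}{\mathrm dP}(x,y)$ is $\mu$-integrable on $\{|x-y|\ge\Lambda R\}$ and $$\frac1{R^2}\int_{\{|x-y|\ge\Lambda R\}}|x-y|^2\,\frac{\mathrm d\pi}{\mathrm dP}(x,y)\,\mathrm d\mu(y)\le K\,e^{-R^2/\varepsilon^2}\,\big(1+E(\pi,2R)\big).$$ -/

import Mathlib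

open MeasureTheory Metric
open scoped NNReal ENNReal

namespace ROT

/-- `ℝ^d` with its Euclidean norm and Lebesgue measure. -/
abbrev Space (d : ℕ) : Type := EuclideanSpace ℝ (Fin d)

/-- `π ∈ Π(lam, mu)`: the first marginal of `π` is `lam`, the second one is `mu`. -/
def IsCoupling {d : ℕ} (lam mu : Measure (Space d)) (π : Measure (Space d × Space d)) : Prop :=
  π.map Prod.fst = lam ∧ π.map Prod.snd = mu

/-- The real-valued version of the Radon-Nikodym density `dπ / dP`, where `P = lam ⊗ mu`. -/
noncomputable def density {d : ℕ} (lam mu : Measure (Space d))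
    (π : Measure (Space d × Space d)) (z : Space d × Space d) : ℝ :=
  (π.rnDeriv (lam.prod mu) z).toReal

/-- The entropic regularisation `h(z) = z log z` (with `h(0) = 0`). -/
noncomputable def entropy (z : ℝ) : ℝ := z * Real.log z

/-- `π` is a coupling of `lam` and `mu` at which the regularised transport functional
`∫ |x - y|² dπ + ε² ∫ h(dπ/dP) dP` is finite. For finite marginals and `h` bounded below, both
terms always make sense in `(-∞, ∞]`; the couplings left out are those where the
functional is `+∞` (with the usual convention that it is `+∞` unless `π ≪ P`). -/
structure IsAdmissible {d : ℕ} (h : ℝ → ℝ) (lam mu : Measure (Space d))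
    (π : Measure (Space d × Space d)) : Prop where
  coupling : IsCoupling lam mu π
  ac : π ≪ lam.prod mu
  integrable_cost : Integrable (fun z : Space d × Space d => ‖z.1 - z.2‖ ^ 2) π
  integrable_reg : Integrable (fun z => h (density lam mu π z)) (lam.prod mu)

/-- The functional `∫ |x - y|² dπ + ε² ∫ h(dπ/dP) dP`, used for admissible couplings only. -/
noncomputable def cost {d : ℕ} (h : ℝ → ℝ) (ε : ℝ) (lam mu : Measure (Space d))
    (π : Measure (Space d × Space d)) : ℝ :=
  (∫ z, ‖z.1 - z.2‖ ^ 2 ∂π) + ε ^ 2 * ∫ z, h (density lam mu π z) ∂(lam.prod mu)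

/-- `π` minimises the regularised optimal transport problem between `lam` and `mu` with
regularisation `h` and parameter `ε`. -/
structure IsMinimiser {d : ℕ} (h : ℝ → ℝ) (ε : ℝ) (lam mu : Measure (Space d))
    (π : Measure (Space d × Space d)) : Prop where
  admissible : IsAdmissible h lam mu π
  le : ∀ π' : Measure (Space d × Space d), IsAdmissible h lam mu π' →
    cost h ε lam mu π ≤ cost h ε lam mu π'

/-- The excess energy `E(π, R) = R^{-(d+2)} ∫_{B_R × ℝ^d} |x - y|² dπ`. -/
noncomputable def excess {d : ℕ} (π : Measure (Space d × Space d)) (R : ℝ) : ℝ :=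
  (R ^ (d + 2))⁻¹ * ∫ z in ball (0 : Space d) R ×ˢ Set.univ, ‖z.1 - z.2‖ ^ 2 ∂π

/-- On `B_R`, the measure `lam` has the nonnegative Lebesgue density `ρ`, and `ρ` is of class
`C^{0,α}` there. -/
structure HasHolderDensityOn {d : ℕ} (α : ℝ≥0) (R : ℝ) (lam : Measure (Space d))
    (ρ : Space d → ℝ) : Prop where
  nonneg : ∀ x ∈ ball (0 : Space d) R, 0 ≤ ρ x
  holder : MemHolder α ((ball (0 : Space d) R).domRestrict ρ)
  restrict_eq : lam.restrict (ball 0 R) =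
    (volume.restrict (ball 0 R)).withDensity (fun x => ENNReal.ofReal (ρ x))

/-- The Hölder seminorm `[ρ]_{α,R}` on `B_R` (of a function that is `C^{0,α}` there). -/
noncomputable def holderSeminorm {d : ℕ} (α : ℝ≥0) (R : ℝ) (ρ : Space d → ℝ) : ℝ :=
  nnHolderNorm α ((ball (0 : Space d) R).domRestrict ρ)

/-- `D(R) = R^{2α} ([ρ]²_{α,R} + [σ]²_{α,R})`, with `ρ`, `σ` the densities of the marginals. -/
noncomputable def dataTerm {d : ℕ} (α : ℝ≥0) (R : ℝ) (ρ σ : Space d → ℝ) : ℝ :=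
  R ^ (2 * (α : ℝ)) * (holderSeminorm α R ρ ^ 2 + holderSeminorm α R σ ^ 2)

end ROT

namespace ROT

/-! The proof rests on a local form of optimality. Write p for the density of π with respect to P.
If pairs (x,y), (x',y') are rewired to (x,y'), (x',y), both marginals are kept, so minimality forces
p(x,y) p(x',y') ≤ p(x,y') p(x',y) exp(Δ/ε²) almost everywhere, where Δ is the change in quadratic
cost (`four_point`). It follows from an integrated first variation (`first_variation`) applied to
the set of quadruples violating the inequality.

Fix x in B_R and a far target y. Some signed coordinate direction e satisfies |y - x| ≤ (d+1)⟨e, y -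
x⟩. Take x' in a small ball and y' in a ball of radius R, both centred at x + (R/2)e. Then x' lies
ahead of x towards y, and the rewiring gains so much that Δ ≤ -R² (`four_point_geometry`). Multiply
by |x - y|² ≤ 4|x' - y|² and integrate in x', y', y. On the left appear the π-mass of the two balls
and the tail at x. On the right, p(x,·) has μ-integral at most one, and the rest is the transport
cost out of B_{2R}, times 4 exp(-R²/ε²) (`measure_mul_lintegral_le`).

The π-mass of the two balls is at least of order cR^d: Hölder control spreads the lower density
bound to B_{2R}, and small excess prevents most of the mass of the small ball from leaving the large
one (`ofReal_le_measure_prod_ball`). Summing over the 2d directions gives the tail bound. -/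

/-! ### Entropy estimates and the first variation. -/

lemma entropy_sub_le_of_pos {p q : ℝ} (hp : 0 ≤ p) (hq : 0 < q) :
    entropy q - entropy p ≤ (q - p) * (1 + Real.log q) := by
  unfold entropy
  rcases hp.eq_or_lt with rfl | hp
  · simp only [zero_mul, sub_zero]
    linarith
  · have h := Real.log_le_sub_one_of_pos (div_pos hq hp)
    rw [Real.log_div hq.ne' hp.ne'] at h
    have h2 := mul_le_mul_of_nonneg_left h hp.le
    have h3 : p * (q / p - 1) = q - p := by field_simp
    nlinarith

/-- By convexity the tangent at the perturbed point q = p + a - b bounds the increment, and q lies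
between p - s and p + s. Moving the logarithms to these endpoints keeps them finite even where p
vanishes, and no limit in the size of the perturbation is needed. -/
lemma entropy_perturb_le {p a b s : ℝ} (hp : 0 ≤ p) (ha : 0 ≤ a) (hb : 0 ≤ b) (hs : 0 < s)
    (has : a ≤ s) (hbs : b ≤ s) (h : b ≠ 0 → 2 * s ≤ p) :
    entropy (p + a - b) - entropy p
      ≤ a * (1 + Real.log (p + s)) - b * (1 + Real.log (p - s)) := by
  by_cases hab : a = 0 ∧ b = 0
  · simp [hab.1, hab.2]
  have hq : 0 < p + a - b := by
    by_cases hb0 : b = 0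
    · have : 0 < a := lt_of_le_of_ne ha fun h => hab ⟨h.symm, hb0⟩
      linarith
    · linarith [h hb0]
  have h1 := entropy_sub_le_of_pos hp hq
  have h2 : a * Real.log (p + a - b) ≤ a * Real.log (p + s) :=
    mul_le_mul_of_nonneg_left (Real.log_le_log hq (by linarith)) ha
  have h3 : b * Real.log (p - s) ≤ b * Real.log (p + a - b) := by
    by_cases hb0 : b = 0
    · simp [hb0]
    · exact mul_le_mul_of_nonneg_left
        (Real.log_le_log (by linarith [h hb0]) (by linarith)) hb
  nlinarith

lemma rnDeriv_le_const {Z : Type*} [MeasurableSpace Z] {P ν : Measure Z} [IsFiniteMeasure P]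
    [IsFiniteMeasure ν] {M : ℝ≥0} (h : ν ≤ M • P) : ∀ᵐ z ∂P, (ν.rnDeriv P z).toReal ≤ M := by
  have hle : ν.rnDeriv P ≤ᵐ[P] fun _ => (M : ℝ≥0∞) := by
    refine ae_le_of_forall_setLIntegral_le_of_sigmaFinite (Measure.measurable_rnDeriv _ _)
      fun s _ _ => ?_
    refine (Measure.setLIntegral_rnDeriv_le s).trans ((h s).trans ?_)
    simp
  filter_upwards [hle] with z hz
  exact ENNReal.toReal_mono ENNReal.coe_ne_top hz

lemma measurable_density {d : ℕ} (lam mu : Measure (Space d)) (π : Measure (Space d × Space d)) :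
    Measurable (density lam mu π) :=
  (Measure.measurable_rnDeriv _ _).ennreal_toReal

lemma density_nonneg {d : ℕ} (lam mu : Measure (Space d)) (π : Measure (Space d × Space d))
    (z : Space d × Space d) : 0 ≤ density lam mu π z :=
  ENNReal.toReal_nonneg

lemma withDensity_toReal_rnDeriv {Z : Type*} [MeasurableSpace Z] {P ν : Measure Z}
    [IsFiniteMeasure P] [IsFiniteMeasure ν] (h : ν ≪ P) :
    P.withDensity (fun z => ENNReal.ofReal (ν.rnDeriv P z).toReal) = ν := by
  conv_rhs => rw [← Measure.withDensity_rnDeriv_eq ν P h]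
  refine withDensity_congr_ae ?_
  filter_upwards [Measure.rnDeriv_ne_top ν P] with z hz
  rw [ENNReal.ofReal_toReal hz]

lemma ae_imp_of_rnDeriv_ne_zero {Z : Type*} [MeasurableSpace Z] {P ν : Measure Z}
    [IsFiniteMeasure P] [IsFiniteMeasure ν] (h : ν ≪ P) {q : Z → Prop} (hq : ∀ᵐ z ∂ν, q z) :
    ∀ᵐ z ∂P, (ν.rnDeriv P z).toReal ≠ 0 → q z := by
  rw [← Measure.withDensity_rnDeriv_eq ν P h,
    ae_withDensity_iff (Measure.measurable_rnDeriv _ _)] at hq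
  filter_upwards [hq] with z hz hne
  exact hz fun h0 => hne (by simp [h0])

/-- The first variation of the regularised transport functional along the perturbation
`νp - νm`, in an integrated form in which the logarithms stay bounded. -/
theorem first_variation {d : ℕ} {ε : ℝ} {lam mu : Measure (Space d)}
    [IsFiniteMeasure lam] [IsFiniteMeasure mu] {π : Measure (Space d × Space d)}
    (hπ : IsMinimiser entropy ε lam mu π) {νp νm : Measure (Space d × Space d)}
    [IsFiniteMeasure νp] [IsFiniteMeasure νm] {M : ℝ≥0}
    (hp : νp ≤ M • lam.prod mu) (hm : νm ≤ M • lam.prod mu)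
    (hfst : νp.map Prod.fst = νm.map Prod.fst) (hsnd : νp.map Prod.snd = νm.map Prod.snd)
    {s N : ℝ} (hs : 0 < s)
    (hpN : ∀ᵐ z ∂νp, density lam mu π z ≤ N ∧ ‖z.1 - z.2‖ ^ 2 ≤ N)
    (hmN : ∀ᵐ z ∂νm, (density lam mu π z ≤ N ∧ ‖z.1 - z.2‖ ^ 2 ≤ N) ∧
      2 * s ≤ density lam mu π z) :
    Integrable (fun z => ‖z.1 - z.2‖ ^ 2 + ε ^ 2 * (1 + Real.log (density lam mu π z + s))) νp ∧
    Integrable (fun z => ‖z.1 - z.2‖ ^ 2 + ε ^ 2 * (1 + Real.log (density lam mu π z - s))) νm ∧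
    ∫ z, (‖z.1 - z.2‖ ^ 2 + ε ^ 2 * (1 + Real.log (density lam mu π z - s))) ∂νm
      ≤ ∫ z, (‖z.1 - z.2‖ ^ 2 + ε ^ 2 * (1 + Real.log (density lam mu π z + s))) ∂νp := by
  set P := lam.prod mu with hP
  set p := density lam mu π with hpdef
  have hpm : Measurable p := measurable_density lam mu π
  have hp0 : ∀ z, 0 ≤ p z := density_nonneg lam mu π
  have hcm : Measurable (fun z : Space d × Space d => ‖z.1 - z.2‖ ^ 2) := by fun_prop
  obtain ⟨⟨hπ1, hπ2⟩, hπac, hπc, hπh⟩ := hπ.admissible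
  have : IsFiniteMeasure π := by
    refine ⟨?_⟩
    have := congrArg (fun m => m Set.univ) hπ1
    simp only [Measure.map_apply measurable_fst MeasurableSet.univ, Set.preimage_univ] at this
    rw [this]
    exact measure_lt_top _ _
  have hacM : ∀ ν : Measure (Space d × Space d), ν ≤ M • P → ν ≪ P := fun ν h =>
    (Measure.absolutelyContinuous_of_le h).trans
      (Measure.smul_absolutelyContinuous (c := M))
  have hpac := hacM _ hp
  have hmac := hacM _ hm
  set u : Space d × Space d → ℝ := fun z => (νp.rnDeriv P z).toReal with hu
  set v : Space d × Space d → ℝ := fun z => (νm.rnDeriv P z).toReal with hv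
  have hum : Measurable u := (Measure.measurable_rnDeriv _ _).ennreal_toReal
  have hvm : Measurable v := (Measure.measurable_rnDeriv _ _).ennreal_toReal
  have hu0 : ∀ z, 0 ≤ u z := fun z => ENNReal.toReal_nonneg
  have hv0 : ∀ z, 0 ≤ v z := fun z => ENNReal.toReal_nonneg
  -- The densities of νp and νm are at most M, so this fixed t keeps both perturbations below s.
  obtain ⟨t, ht, htM⟩ : ∃ t : ℝ, 0 < t ∧ t * M ≤ s := by
    refine ⟨s / (M + 1), by positivity, ?_⟩
    rw [div_mul_eq_mul_div, div_le_iff₀ (by positivity)]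
    nlinarith [M.2, hs]
  have huM : ∀ᵐ z ∂P, t * u z ≤ s := by
    filter_upwards [rnDeriv_le_const hp] with z hz
    exact (mul_le_mul_of_nonneg_left hz ht.le).trans htM
  have hvM : ∀ᵐ z ∂P, t * v z ≤ s := by
    filter_upwards [rnDeriv_le_const hm] with z hz
    exact (mul_le_mul_of_nonneg_left hz ht.le).trans htM
  have huN := ae_imp_of_rnDeriv_ne_zero hpac hpN
  have hvN := ae_imp_of_rnDeriv_ne_zero hmac hmN
  set q : Space d × Space d → ℝ := fun z => p z + t * u z - t * v z with hq
  have hqm : Measurable q := (hpm.add (hum.const_mul t)).sub (hvm.const_mul t)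
  have hq0 : ∀ᵐ z ∂P, 0 ≤ q z := by
    filter_upwards [hvM, hvN] with z h1 h2
    have := mul_nonneg ht.le (hu0 z)
    by_cases h : v z = 0
    · simp only [hq, h]
      linarith [hp0 z]
    · simp only [hq]
      linarith [(h2 h).2]
  set π' := P.withDensity fun z => ENNReal.ofReal (q z) with hπ'
  -- Stating π' = π + t(νp - νm) additively avoids subtraction of measures; marginals and costs are
  -- then compared by cancellation.
  have hsum : π' + ENNReal.ofReal t • νm = π + ENNReal.ofReal t • νp := by
    have e1 : ENNReal.ofReal t • νm = P.withDensity fun z => ENNReal.ofReal (t * v z) := by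
      conv_lhs => rw [← withDensity_toReal_rnDeriv hmac]
      rw [← withDensity_smul _ hvm.ennreal_ofReal]
      congr 1; ext z
      simp [ENNReal.ofReal_mul ht.le, hv]
    have e2 : ENNReal.ofReal t • νp = P.withDensity fun z => ENNReal.ofReal (t * u z) := by
      conv_lhs => rw [← withDensity_toReal_rnDeriv hpac]
      rw [← withDensity_smul _ hum.ennreal_ofReal]
      congr 1; ext z
      simp [ENNReal.ofReal_mul ht.le, hu]
    have e3 : π = P.withDensity fun z => ENNReal.ofReal (p z) :=
      (withDensity_toReal_rnDeriv hπac).symm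
    rw [e1, e2, hπ']
    conv_rhs => rw [e3]
    rw [← withDensity_add_left hqm.ennreal_ofReal, ← withDensity_add_left hpm.ennreal_ofReal]
    refine withDensity_congr_ae ?_
    filter_upwards [hq0] with z hz
    simp only [Pi.add_apply]
    rw [← ENNReal.ofReal_add hz (mul_nonneg ht.le (hv0 z)),
      ← ENNReal.ofReal_add (hp0 z) (mul_nonneg ht.le (hu0 z))]
    congr 1
    simp only [hq]; ring
  have : IsFiniteMeasure (ENNReal.ofReal t • νm) := Measure.smul_finite _ ENNReal.ofReal_ne_top
  have : IsFiniteMeasure (ENNReal.ofReal t • νp) := Measure.smul_finite _ ENNReal.ofReal_ne_top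
  have hmarg : ∀ f : Space d × Space d → Space d, Measurable f → νp.map f = νm.map f →
      π'.map f = π.map f := by
    intro f hf h
    have h1 := congrArg (Measure.map f) hsum
    rw [Measure.map_add _ _ hf, Measure.map_add _ _ hf, Measure.map_smul, Measure.map_smul,
      h] at h1
    have : IsFiniteMeasure (ENNReal.ofReal t • νm.map f) :=
      Measure.smul_finite _ ENNReal.ofReal_ne_top
    exact (Measure.add_left_inj _ _ _).1 h1
  have hcp : Integrable (fun z : Space d × Space d => ‖z.1 - z.2‖ ^ 2) νp := by
    refine Integrable.of_bound hcm.aestronglyMeasurable N ?_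
    filter_upwards [hpN] with z hz
    rw [Real.norm_of_nonneg (by positivity)]
    exact hz.2
  have hcm' : Integrable (fun z : Space d × Space d => ‖z.1 - z.2‖ ^ 2) νm := by
    refine Integrable.of_bound hcm.aestronglyMeasurable N ?_
    filter_upwards [hmN] with z hz
    rw [Real.norm_of_nonneg (by positivity)]
    exact hz.1.2
  have hcsum : Integrable (fun z : Space d × Space d => ‖z.1 - z.2‖ ^ 2)
      (π + ENNReal.ofReal t • νp) := hπc.add_measure (hcp.smul_measure ENNReal.ofReal_ne_top)
  have hcπ' : Integrable (fun z : Space d × Space d => ‖z.1 - z.2‖ ^ 2) π' := by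
    rw [← hsum] at hcsum
    exact hcsum.mono_measure (Measure.le_add_right le_rfl)
  have hdens : density lam mu π' =ᵐ[P] q := by
    filter_upwards [Measure.rnDeriv_withDensity P hqm.ennreal_ofReal, hq0] with z hz hz0
    simp only [density]
    rw [← hP, hz, ENNReal.toReal_ofReal hz0]
  have hhm : Measurable entropy := Real.continuous_mul_log.measurable
  have hhq : Integrable (fun z => entropy (q z)) P := by
    -- Where the density is changed, p ≤ N, so q stays in the compact interval [0, N + s]; elsewhere
    -- q = p and the finite entropy of π applies.
    obtain ⟨b, hb⟩ := (isCompact_Icc (a := (0 : ℝ)) (b := N + s)).exists_bound_of_continuousOn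
      (f := entropy) Real.continuous_mul_log.continuousOn
    refine (hπh.norm.add (integrable_const |b|)).mono' (hhm.comp hqm).aestronglyMeasurable ?_
    filter_upwards [huM, hvN, huN, hq0] with z h1 h2 h3 h4
    have hb' := abs_nonneg b
    have hn := norm_nonneg (entropy (density lam mu π z))
    simp only [Pi.add_apply]
    by_cases hz : u z = 0 ∧ v z = 0
    · have : q z = density lam mu π z := by simp [hq, hz.1, hz.2, hpdef]
      rw [this]
      linarith
    · have hpz : p z ≤ N := by
        by_cases huz : u z = 0
        · exact (h2 fun h => hz ⟨huz, h⟩).1.1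
        · exact (h3 huz).1
      have := hb (q z) ⟨h4, by
        simp only [hq]
        linarith [mul_nonneg ht.le (hv0 z)]⟩
      linarith [le_abs_self b]
  have hadm : IsAdmissible entropy lam mu π' := by
    refine ⟨⟨(hmarg _ measurable_fst hfst).trans hπ1, (hmarg _ measurable_snd hsnd).trans hπ2⟩,
      withDensity_absolutelyContinuous _ _, hcπ', ?_⟩
    refine hhq.congr ?_
    filter_upwards [hdens] with z hz
    rw [hz]
  have hmin := hπ.le π' hadm
  unfold cost at hmin
  have hreg : ∫ z, entropy (density lam mu π' z) ∂P = ∫ z, entropy (q z) ∂P := by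
    refine integral_congr_ae ?_
    filter_upwards [hdens] with z hz
    rw [hz]
  rw [← hP, hreg] at hmin
  have hcost : (∫ z, ‖z.1 - z.2‖ ^ 2 ∂π') + t * ∫ z, ‖z.1 - z.2‖ ^ 2 ∂νm
      = (∫ z, ‖z.1 - z.2‖ ^ 2 ∂π) + t * ∫ z, ‖z.1 - z.2‖ ^ 2 ∂νp := by
    have := congrArg (fun m => ∫ z, ‖z.1 - z.2‖ ^ 2 ∂m) hsum
    rw [integral_add_measure hcπ' (hcm'.smul_measure ENNReal.ofReal_ne_top),
      integral_add_measure hπc (hcp.smul_measure ENNReal.ofReal_ne_top),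
      integral_smul_measure, integral_smul_measure, ENNReal.toReal_ofReal ht.le] at this
    simpa using this
  have hlp : Integrable (fun z => 1 + Real.log (p z + s)) νp := by
    refine Integrable.of_bound ((measurable_const.add
      (Real.measurable_log.comp (hpm.add_const s)))).aestronglyMeasurable
      (1 + (|Real.log s| + |Real.log (N + s)|)) ?_
    filter_upwards [hpN] with z hz
    refine (norm_add_le _ _).trans ?_
    rw [norm_one, Real.norm_eq_abs]
    gcongr
    have l1 := Real.log_le_log hs (show s ≤ p z + s by linarith [hp0 z])
    have l2 := Real.log_le_log (by linarith [hp0 z]) (show p z + s ≤ N + s by linarith [hz.1])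
    rw [abs_le]
    constructor
    · linarith [neg_abs_le (Real.log s), abs_nonneg (Real.log (N + s))]
    · linarith [le_abs_self (Real.log (N + s)), abs_nonneg (Real.log s)]
  have hlm : Integrable (fun z => 1 + Real.log (p z - s)) νm := by
    refine Integrable.of_bound ((measurable_const.add
      (Real.measurable_log.comp (hpm.sub_const s)))).aestronglyMeasurable
      (1 + (|Real.log s| + |Real.log N|)) ?_
    filter_upwards [hmN] with z hz
    refine (norm_add_le _ _).trans ?_
    rw [norm_one, Real.norm_eq_abs]
    gcongr
    have l1 := Real.log_le_log hs (show s ≤ p z - s by linarith [hz.2])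
    have l2 := Real.log_le_log (by linarith [hz.2]) (show p z - s ≤ N by linarith [hz.1.1])
    rw [abs_le]
    constructor
    · linarith [neg_abs_le (Real.log s), abs_nonneg (Real.log N)]
    · linarith [le_abs_self (Real.log N), abs_nonneg (Real.log s)]
  have hlp' := (integrable_rnDeriv_smul_iff hpac).2 hlp
  have hlm' := (integrable_rnDeriv_smul_iff hmac).2 hlm
  have hent : (∫ z, entropy (q z) ∂P) - ∫ z, entropy (p z) ∂P
      ≤ t * ((∫ z, (1 + Real.log (p z + s)) ∂νp) - ∫ z, (1 + Real.log (p z - s)) ∂νm) := by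
    rw [← integral_rnDeriv_smul hpac, ← integral_rnDeriv_smul hmac, ← integral_sub hhq hπh,
      ← integral_sub hlp' hlm', ← integral_const_mul]
    refine integral_mono_ae (hhq.sub hπh) ((hlp'.sub hlm').const_mul t) ?_
    filter_upwards [huM, hvM, hvN] with z h1 h2 h3
    have := entropy_perturb_le (hp0 z) (mul_nonneg ht.le (hu0 z)) (mul_nonneg ht.le (hv0 z)) hs
      h1 h2 fun h => (h3 fun h0 => h (by simp [hv, h0])).2
    simp only [smul_eq_mul]
    calc _ ≤ _ := this
      _ = _ := by simp only [hu, hv]; ring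
  have h2 := mul_le_mul_of_nonneg_left hent (sq_nonneg ε)
  set A := ∫ z, (1 + Real.log (p z + s)) ∂νp
  set B := ∫ z, (1 + Real.log (p z - s)) ∂νm
  have : 0 ≤ t * ((∫ z, ‖z.1 - z.2‖ ^ 2 ∂νp) - (∫ z, ‖z.1 - z.2‖ ^ 2 ∂νm)
      + ε ^ 2 * (A - B)) := by nlinarith
  have h3 := nonneg_of_mul_nonneg_right this ht
  refine ⟨hcp.add (hlp.const_mul _), hcm'.add (hlm.const_mul _), ?_⟩
  rw [integral_add hcp (hlp.const_mul _), integral_add hcm' (hlm.const_mul _),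
    integral_const_mul, integral_const_mul]
  linarith

/-! ### The four point inequality. -/

/-- The coordinates of a product measure are independent, so crossing two independent pairs again
gives P, up to total mass. This bounds the rewired measures by multiples of P. -/
lemma map_fst_fst_snd_snd_eq {X Y : Type*} [MeasurableSpace X] [MeasurableSpace Y]
    (lam : Measure X) (mu : Measure Y) [IsFiniteMeasure lam] [IsFiniteMeasure mu] :
    ((lam.prod mu).prod (lam.prod mu)).map (fun w => (w.1.1, w.2.2))
      = (lam.prod mu Set.univ) • lam.prod mu := by
  have h := Measure.map_prod_map (lam.prod mu) (lam.prod mu)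
    (measurable_fst (α := X) (β := Y)) (measurable_snd (α := X) (β := Y))
  have e : (fun w : (X × Y) × (X × Y) => (w.1.1, w.2.2)) = Prod.map Prod.fst Prod.snd := rfl
  rw [e, ← h, Measure.map_fst_prod, Measure.map_snd_prod, Measure.prod_smul_left,
    Measure.prod_smul_right, smul_smul, ← Set.univ_prod_univ, Measure.prod_prod, mul_comm]

lemma map_snd_fst_fst_snd_eq {X Y : Type*} [MeasurableSpace X] [MeasurableSpace Y]
    (lam : Measure X) (mu : Measure Y) [IsFiniteMeasure lam] [IsFiniteMeasure mu] :
    ((lam.prod mu).prod (lam.prod mu)).map (fun w => (w.2.1, w.1.2))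
      = (lam.prod mu Set.univ) • lam.prod mu := by
  have e : (fun w : (X × Y) × (X × Y) => (w.2.1, w.1.2))
      = (fun w : (X × Y) × (X × Y) => (w.1.1, w.2.2)) ∘ Prod.swap := rfl
  rw [e, ← Measure.map_map (by fun_prop) measurable_swap, Measure.prod_swap,
    map_fst_fst_snd_snd_eq]

/-- The set of quadruples violating the four point inequality with a margin `s`, all quantities
being bounded by `N`. -/
def violationSet {d : ℕ} (ε s N : ℝ) (p : Space d × Space d → ℝ) :
    Set ((Space d × Space d) × (Space d × Space d)) :=
  {w | (2 * s ≤ p w.1 ∧ 2 * s ≤ p w.2) ∧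
    ((p (w.1.1, w.2.2) ≤ N ∧ ‖w.1.1 - w.2.2‖ ^ 2 ≤ N) ∧
      (p (w.2.1, w.1.2) ≤ N ∧ ‖w.2.1 - w.1.2‖ ^ 2 ≤ N)) ∧
    ((p w.1 ≤ N ∧ ‖w.1.1 - w.1.2‖ ^ 2 ≤ N) ∧ (p w.2 ≤ N ∧ ‖w.2.1 - w.2.2‖ ^ 2 ≤ N)) ∧
    (p (w.1.1, w.2.2) + s) * (p (w.2.1, w.1.2) + s) *
      Real.exp ((‖w.1.1 - w.2.2‖ ^ 2 + ‖w.2.1 - w.1.2‖ ^ 2 - ‖w.1.1 - w.1.2‖ ^ 2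
        - ‖w.2.1 - w.2.2‖ ^ 2) / ε ^ 2) < (p w.1 - s) * (p w.2 - s)}

lemma measurableSet_violationSet {d : ℕ} (ε s N : ℝ) {p : Space d × Space d → ℝ}
    (hp : Measurable p) : MeasurableSet (violationSet ε s N p) := by
  have h14 : Measurable fun w : (Space d × Space d) × (Space d × Space d) =>
    p (w.1.1, w.2.2) := hp.comp (by fun_prop)
  have h23 : Measurable fun w : (Space d × Space d) × (Space d × Space d) =>
    p (w.2.1, w.1.2) := hp.comp (by fun_prop)
  have h1 : Measurable fun w : (Space d × Space d) × (Space d × Space d) => p w.1 :=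
    hp.comp (by fun_prop)
  have h2 : Measurable fun w : (Space d × Space d) × (Space d × Space d) => p w.2 :=
    hp.comp (by fun_prop)
  have hx : Measurable fun w : (Space d × Space d) × (Space d × Space d) =>
      Real.exp ((‖w.1.1 - w.2.2‖ ^ 2 + ‖w.2.1 - w.1.2‖ ^ 2 - ‖w.1.1 - w.1.2‖ ^ 2
        - ‖w.2.1 - w.2.2‖ ^ 2) / ε ^ 2) := by fun_prop
  have c14 : Measurable fun w : (Space d × Space d) × (Space d × Space d) =>
    ‖w.1.1 - w.2.2‖ ^ 2 := by fun_prop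
  have c23 : Measurable fun w : (Space d × Space d) × (Space d × Space d) =>
    ‖w.2.1 - w.1.2‖ ^ 2 := by fun_prop
  have c1 : Measurable fun w : (Space d × Space d) × (Space d × Space d) =>
    ‖w.1.1 - w.1.2‖ ^ 2 := by fun_prop
  have c2 : Measurable fun w : (Space d × Space d) × (Space d × Space d) =>
    ‖w.2.1 - w.2.2‖ ^ 2 := by fun_prop
  have k {a : ℝ} : Measurable fun _ : (Space d × Space d) × (Space d × Space d) => a :=
    measurable_const
  exact ((measurableSet_le k h1).inter (measurableSet_le k h2)).inter
    ((((measurableSet_le h14 k).inter (measurableSet_le c14 k)).inter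
      ((measurableSet_le h23 k).inter (measurableSet_le c23 k))).inter
    ((((measurableSet_le h1 k).inter (measurableSet_le c1 k)).inter
      ((measurableSet_le h2 k).inter (measurableSet_le c2 k))).inter
    (measurableSet_lt (((h14.add_const s).mul (h23.add_const s)).mul hx)
      ((h1.sub_const s).mul (h2.sub_const s)))))

/-- Restrict P ⊗ P to the violating quadruples and use the crossed pairs as νp, the original pairs
as νm. The first variation is then an integral of a strictly positive function that is at most zero,
so the restricted measure vanishes. -/
lemma measure_violationSet_eq_zero {d : ℕ} {ε : ℝ} (hε : 0 < ε) {lam mu : Measure (Space d)}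
    [IsFiniteMeasure lam] [IsFiniteMeasure mu] {π : Measure (Space d × Space d)}
    (hπ : IsMinimiser entropy ε lam mu π) {s : ℝ} (hs : 0 < s) (N : ℝ) :
    ((lam.prod mu).prod (lam.prod mu)) (violationSet ε s N (density lam mu π)) = 0 := by
  set P := lam.prod mu with hP
  set p := density lam mu π with hpdef
  set G := violationSet ε s N p with hGdef
  have hpm : Measurable p := measurable_density lam mu π
  have hG : MeasurableSet G := measurableSet_violationSet ε s N hpm
  have hp0 : ∀ z, 0 ≤ p z := density_nonneg lam mu π
  set γ := (P.prod P).restrict G with hγ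
  have hγG : ∀ᵐ w ∂γ, w ∈ G := ae_restrict_mem hG
  let φ₁ : (Space d × Space d) × (Space d × Space d) → Space d × Space d :=
    fun w => (w.1.1, w.2.2)
  let φ₂ : (Space d × Space d) × (Space d × Space d) → Space d × Space d :=
    fun w => (w.2.1, w.1.2)
  have m₁ : Measurable φ₁ := by fun_prop
  have m₂ : Measurable φ₂ := by fun_prop
  have hmap : ∀ φ : (Space d × Space d) × (Space d × Space d) → Space d × Space d,
      Measurable φ → (P.prod P).map φ = P Set.univ • P → γ.map φ ≤ P Set.univ • P :=
    fun φ hφ h => h ▸ Measure.map_mono Measure.restrict_le_self hφ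
  have l₁ := hmap φ₁ m₁ (map_fst_fst_snd_snd_eq lam mu)
  have l₂ := hmap φ₂ m₂ (map_snd_fst_fst_snd_eq lam mu)
  have l₃ := hmap Prod.fst measurable_fst Measure.map_fst_prod
  have l₄ := hmap Prod.snd measurable_snd Measure.map_snd_prod
  have hM : ((2 * P Set.univ).toNNReal : ℝ≥0) • P = P Set.univ • P + P Set.univ • P := by
    rw [← add_smul, ← two_mul]
    have : 2 * P Set.univ ≠ ⊤ := ENNReal.mul_ne_top (by simp) (measure_ne_top _ _)
    ext t _
    simp only [Measure.smul_apply, smul_eq_mul, Measure.nnreal_smul_coe_apply]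
    rw [ENNReal.coe_toNNReal this]
  have hfst : (γ.map φ₁ + γ.map φ₂).map Prod.fst
      = (γ.map Prod.fst + γ.map Prod.snd).map Prod.fst := by
    rw [Measure.map_add _ _ measurable_fst, Measure.map_add _ _ measurable_fst,
      Measure.map_map measurable_fst m₁, Measure.map_map measurable_fst m₂,
      Measure.map_map measurable_fst measurable_fst,
      Measure.map_map measurable_fst measurable_snd]
    rfl
  have hsnd : (γ.map φ₁ + γ.map φ₂).map Prod.snd
      = (γ.map Prod.fst + γ.map Prod.snd).map Prod.snd := by
    rw [Measure.map_add _ _ measurable_snd, Measure.map_add _ _ measurable_snd,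
      Measure.map_map measurable_snd m₁, Measure.map_map measurable_snd m₂,
      Measure.map_map measurable_snd measurable_fst,
      Measure.map_map measurable_snd measurable_snd, add_comm]
    rfl
  have hcm : Measurable (fun z : Space d × Space d => ‖z.1 - z.2‖ ^ 2) := by fun_prop
  have hbd : MeasurableSet {z : Space d × Space d | p z ≤ N ∧ ‖z.1 - z.2‖ ^ 2 ≤ N} :=
    (measurableSet_le hpm measurable_const).inter (measurableSet_le hcm measurable_const)
  have hbd2 : MeasurableSet
      {z : Space d × Space d | (p z ≤ N ∧ ‖z.1 - z.2‖ ^ 2 ≤ N) ∧ 2 * s ≤ p z} :=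
    hbd.inter (measurableSet_le measurable_const hpm)
  obtain ⟨ip, im, hle⟩ := first_variation hπ (νp := γ.map φ₁ + γ.map φ₂)
    (νm := γ.map Prod.fst + γ.map Prod.snd) (M := (2 * P Set.univ).toNNReal)
    (hM ▸ add_le_add l₁ l₂) (hM ▸ add_le_add l₃ l₄) hfst hsnd hs (N := N)
    (by
      rw [ae_add_measure_iff, ae_map_iff m₁.aemeasurable hbd, ae_map_iff m₂.aemeasurable hbd]
      exact ⟨hγG.mono fun w hw => hw.2.1.1, hγG.mono fun w hw => hw.2.1.2⟩)
    (by
      rw [ae_add_measure_iff, ae_map_iff measurable_fst.aemeasurable hbd2,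
        ae_map_iff measurable_snd.aemeasurable hbd2]
      exact ⟨hγG.mono fun w hw => ⟨hw.2.2.1.1, hw.1.1⟩,
        hγG.mono fun w hw => ⟨hw.2.2.1.2, hw.1.2⟩⟩)
  set f : Space d × Space d → ℝ :=
    fun z => ‖z.1 - z.2‖ ^ 2 + ε ^ 2 * (1 + Real.log (p z + s)) with hf
  set g : Space d × Space d → ℝ :=
    fun z => ‖z.1 - z.2‖ ^ 2 + ε ^ 2 * (1 + Real.log (p z - s)) with hg
  obtain ⟨i₁, i₂⟩ := integrable_add_measure.1 ip
  obtain ⟨i₃, i₄⟩ := integrable_add_measure.1 im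
  rw [integral_add_measure i₁ i₂, integral_add_measure i₃ i₄,
    integral_map m₁.aemeasurable i₁.1, integral_map m₂.aemeasurable i₂.1,
    integral_map measurable_fst.aemeasurable i₃.1,
    integral_map measurable_snd.aemeasurable i₄.1] at hle
  replace i₁ := i₁.comp_measurable m₁
  replace i₂ := i₂.comp_measurable m₂
  replace i₃ := i₃.comp_measurable measurable_fst
  replace i₄ := i₄.comp_measurable measurable_snd
  -- Taking logarithms turns the multiplicative violation into a strict gain in the first variation.
  have hneg : ∀ w ∈ G, 0 < g w.1 + g w.2 - (f (φ₁ w) + f (φ₂ w)) := by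
    rintro w ⟨⟨h1, h2⟩, -, -, hlt⟩
    have q1 : 0 < p w.1 - s := by linarith
    have q2 : 0 < p w.2 - s := by linarith
    have q3 : 0 < p (w.1.1, w.2.2) + s := by linarith [hp0 (w.1.1, w.2.2)]
    have q4 : 0 < p (w.2.1, w.1.2) + s := by linarith [hp0 (w.2.1, w.1.2)]
    have := Real.log_lt_log (by positivity) hlt
    rw [Real.log_mul (by positivity) (by positivity), Real.log_mul q3.ne' q4.ne',
      Real.log_mul q1.ne' q2.ne', Real.log_exp] at this
    have h3 := mul_lt_mul_of_pos_left this (show 0 < ε ^ 2 by positivity)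
    rw [mul_add, mul_div_cancel₀ _ (show ε ^ 2 ≠ 0 by positivity)] at h3
    simp only [hf, hg, φ₁, φ₂]
    linarith
  have hint : ∫ w, (g w.1 + g w.2 - (f (φ₁ w) + f (φ₂ w))) ∂γ ≤ 0 := by
    have e1 := integral_add i₁ i₂
    have e2 := integral_add i₃ i₄
    have e3 := integral_sub (i₃.add i₄) (i₁.add i₂)
    simp only [Function.comp_apply, Pi.add_apply] at e1 e2 e3
    rw [e3, e1, e2]
    exact sub_nonpos.2 hle
  have hnn : 0 ≤ᵐ[γ] fun w => g w.1 + g w.2 - (f (φ₁ w) + f (φ₂ w)) :=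
    hγG.mono fun w hw => (hneg w hw).le
  have hz := (integral_eq_zero_iff_of_nonneg_ae hnn ((i₃.add i₄).sub (i₁.add i₂))).1
    (le_antisymm hint (integral_nonneg_of_ae hnn))
  have hfalse : ∀ᵐ w ∂γ, False := by
    filter_upwards [hz, hγG] with w h1 h2
    exact (hneg w h2).ne' h1
  have : γ = 0 := by
    rwa [Filter.eventually_false_iff_eq_bot, ae_eq_bot] at hfalse
  exact Measure.restrict_eq_zero.1 this

/-- The four point inequality for the density of an entropic optimal plan. -/
theorem four_point {d : ℕ} {ε : ℝ} (hε : 0 < ε) {lam mu : Measure (Space d)}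
    [IsFiniteMeasure lam] [IsFiniteMeasure mu] {π : Measure (Space d × Space d)}
    (hπ : IsMinimiser entropy ε lam mu π) :
    ∀ᵐ w ∂(lam.prod mu).prod (lam.prod mu),
      density lam mu π w.1 * density lam mu π w.2 ≤
        density lam mu π (w.1.1, w.2.2) * density lam mu π (w.2.1, w.1.2) *
        Real.exp ((‖w.1.1 - w.2.2‖ ^ 2 + ‖w.2.1 - w.1.2‖ ^ 2 - ‖w.1.1 - w.1.2‖ ^ 2
          - ‖w.2.1 - w.2.2‖ ^ 2) / ε ^ 2) := by
  have h : ∀ᵐ w ∂(lam.prod mu).prod (lam.prod mu), ∀ n : ℕ,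
      w ∉ violationSet ε (1 / ((n : ℝ) + 1)) n (density lam mu π) := by
    refine ae_all_iff.2 fun n => ?_
    rw [ae_iff]
    simpa using measure_violationSet_eq_zero hε hπ (s := 1 / ((n : ℝ) + 1)) (by positivity) n
  filter_upwards [h] with w hw
  by_contra! hlt
  set p := density lam mu π
  have hp0 : ∀ z, 0 ≤ p z := density_nonneg lam mu π
  have hpos : 0 < p w.1 * p w.2 := lt_of_le_of_lt
    (mul_nonneg (mul_nonneg (hp0 _) (hp0 _)) (Real.exp_pos _).le) hlt
  have h1 : 0 < p w.1 := lt_of_le_of_ne (hp0 _) fun h => by simp [← h] at hpos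
  have h2 : 0 < p w.2 := lt_of_le_of_ne (hp0 _) fun h => by simp [← h] at hpos
  -- A strict violation at w survives a small margin s = 1/(n+1), and every truncation holds once n
  -- is large, so w would lie in one of countably many null sets.
  have hs : Filter.Tendsto (fun n : ℕ => 1 / ((n : ℝ) + 1)) Filter.atTop (nhds 0) :=
    tendsto_one_div_add_atTop_nhds_zero_nat
  have big : ∀ a : ℝ, ∀ᶠ n : ℕ in Filter.atTop, a ≤ n := fun a =>
    tendsto_natCast_atTop_atTop.eventually_ge_atTop a
  have small : ∀ a : ℝ, 0 < a → ∀ᶠ n : ℕ in Filter.atTop, 2 * (1 / ((n : ℝ) + 1)) ≤ a := by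
    intro a ha
    have := hs.const_mul 2
    rw [mul_zero] at this
    exact (this.eventually_lt_const ha).mono fun _ h => h.le
  set x := Real.exp ((‖w.1.1 - w.2.2‖ ^ 2 + ‖w.2.1 - w.1.2‖ ^ 2 - ‖w.1.1 - w.1.2‖ ^ 2
          - ‖w.2.1 - w.2.2‖ ^ 2) / ε ^ 2) with hx
  have hl : Filter.Tendsto (fun n : ℕ => (p (w.1.1, w.2.2) + 1 / ((n : ℝ) + 1)) *
      (p (w.2.1, w.1.2) + 1 / ((n : ℝ) + 1)) * x) Filter.atTop
      (nhds ((p (w.1.1, w.2.2) + 0) * (p (w.2.1, w.1.2) + 0) * x)) :=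
    ((hs.const_add _).mul (hs.const_add _)).mul_const _
  have hr : Filter.Tendsto (fun n : ℕ => (p w.1 - 1 / ((n : ℝ) + 1)) *
      (p w.2 - 1 / ((n : ℝ) + 1))) Filter.atTop (nhds ((p w.1 - 0) * (p w.2 - 0))) :=
    (hs.const_sub _).mul (hs.const_sub _)
  have hev := hl.eventually_lt hr (by simpa using hlt)
  obtain ⟨n, a1, a2, a3, a4, a5, a6, a7, a8, a9, a10, a11⟩ :=
    ((small _ h1).and <| (small _ h2).and <| (big _).and <| (big _).and <| (big _).and <|
      (big _).and <| (big _).and <| (big _).and <| (big _).and <| (big _).and hev).exists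
  exact hw n ⟨⟨a1, a2⟩, ⟨⟨a3, a4⟩, ⟨a5, a6⟩⟩, ⟨⟨a7, a8⟩, ⟨a9, a10⟩⟩, a11⟩

/-! ### Lower density bound, marginal bound and integrated inequality. -/

lemma smul_volume_restrict_le {d : ℕ} {α : ℝ≥0} {R c : ℝ} {lam : Measure (Space d)}
    {ρ : Space d → ℝ} (hR : 0 < R) (h : HasHolderDensityOn α (2 * R) lam ρ)
    (hc : ∀ x ∈ ball (0 : Space d) R, c ≤ ρ x)
    (hosc : (2 * R) ^ (α : ℝ) * holderSeminorm α (2 * R) ρ ≤ c / 2) :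
    ENNReal.ofReal (c / 2) • volume.restrict (ball (0 : Space d) (2 * R)) ≤ lam := by
  have hlow : ∀ x ∈ ball (0 : Space d) (2 * R), c / 2 ≤ ρ x := by
    -- Compare x with x/2, which lies in B_R where the density is at least c; the Hölder oscillation
    -- costs at most c/2.
    intro x hx
    have hx' := mem_ball_zero_iff.1 hx
    have hn : ‖(1 / 2 : ℝ) • x‖ = ‖x‖ / 2 := by
      rw [norm_smul]; norm_num; ring
    have hy : (1 / 2 : ℝ) • x ∈ ball (0 : Space d) R := by
      rw [mem_ball_zero_iff, hn]; linarith
    have hy2 : (1 / 2 : ℝ) • x ∈ ball (0 : Space d) (2 * R) :=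
      ball_subset_ball (by linarith) hy
    have hd : dist x ((1 / 2 : ℝ) • x) ≤ 2 * R := by
      have : x - (1 / 2 : ℝ) • x = (1 / 2 : ℝ) • x := by
        rw [sub_eq_iff_eq_add, ← add_smul]; norm_num
      rw [dist_eq_norm, this, hn]; linarith
    have hH := h.holder.holderWith.dist_le ⟨x, hx⟩ ⟨_, hy2⟩
    simp only [Set.domRestrict_apply, Subtype.dist_eq] at hH
    have hpow : dist x ((1 / 2 : ℝ) • x) ^ (α : ℝ) ≤ (2 * R) ^ (α : ℝ) :=
      Real.rpow_le_rpow dist_nonneg hd α.2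
    have hs : (0 : ℝ) ≤ holderSeminorm α (2 * R) ρ := NNReal.coe_nonneg _
    have h3 : dist (ρ x) (ρ ((1 / 2 : ℝ) • x)) ≤ c / 2 := by
      refine hH.trans (le_trans ?_ hosc)
      rw [mul_comm]
      exact mul_le_mul_of_nonneg_right hpow hs
    rw [Real.dist_eq, abs_le] at h3
    linarith [hc _ hy, h3.1]
  refine le_trans ?_ (Measure.restrict_le_self (s := ball (0 : Space d) (2 * R)))
  rw [h.restrict_eq, ← withDensity_const]
  refine withDensity_mono ?_
  filter_upwards [ae_restrict_mem measurableSet_ball] with x hx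
  exact ENNReal.ofReal_le_ofReal (hlow x hx)

lemma lintegral_density_le_one {d : ℕ} {lam mu : Measure (Space d)}
    [IsFiniteMeasure lam] [IsFiniteMeasure mu] {π : Measure (Space d × Space d)}
    (h1 : π.map Prod.fst = lam) (hw : (lam.prod mu).withDensity
      (fun z => ENNReal.ofReal (density lam mu π z)) = π) :
    ∀ᵐ x ∂lam, ∫⁻ y, ENNReal.ofReal (density lam mu π (x, y)) ∂mu ≤ 1 := by
  have hm := (measurable_density lam mu π).ennreal_ofReal
  refine ae_le_of_forall_setLIntegral_le_of_sigmaFinite hm.lintegral_prod_right'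
    fun s hs _ => ?_
  simp only [lintegral_const, one_mul, Measure.restrict_apply MeasurableSet.univ,
    Set.univ_inter]
  rw [← lintegral_prod _ hm.aemeasurable]
  have : (lam.restrict s).prod mu = (lam.prod mu).restrict (s ×ˢ Set.univ) := by
    rw [← Measure.prod_restrict, Measure.restrict_univ]
  rw [this, ← withDensity_apply _ (hs.prod MeasurableSet.univ), hw]
  conv_rhs => rw [← h1]
  rw [Measure.map_apply measurable_fst hs, Set.prod_univ]

/-- The four point inequality integrated over `(x', y') ∈ A × B` and `y ∈ S`. -/
lemma measure_mul_lintegral_le {d : ℕ} {lam mu : Measure (Space d)}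
    [IsFiniteMeasure lam] [IsFiniteMeasure mu] {π : Measure (Space d × Space d)}
    [IsFiniteMeasure π] (hw : (lam.prod mu).withDensity
      (fun z => ENNReal.ofReal (density lam mu π z)) = π) {ε r : ℝ} {x : Space d}
    (hx1 : ∫⁻ y, ENNReal.ofReal (density lam mu π (x, y)) ∂mu ≤ 1)
    (hx4 : ∀ᵐ y ∂mu, ∀ᵐ z ∂lam.prod mu, density lam mu π (x, y) * density lam mu π z ≤
        density lam mu π (x, z.2) * density lam mu π (z.1, y) *
        Real.exp ((‖x - z.2‖ ^ 2 + ‖z.1 - y‖ ^ 2 - ‖x - y‖ ^ 2 - ‖z.1 - z.2‖ ^ 2) / ε ^ 2))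
    {A B S : Set (Space d)} (hA : MeasurableSet A) (hB : MeasurableSet B) (hS : MeasurableSet S)
    (hgeo : ∀ y ∈ S, ∀ x' ∈ A, ∀ y' ∈ B,
      (‖x - y'‖ ^ 2 + ‖x' - y‖ ^ 2 - ‖x - y‖ ^ 2 - ‖x' - y'‖ ^ 2) / ε ^ 2 ≤ r ∧
      ‖x - y‖ ^ 2 ≤ 4 * ‖x' - y‖ ^ 2) :
    π (A ×ˢ B) * ∫⁻ y in S, ENNReal.ofReal (‖x - y‖ ^ 2 * density lam mu π (x, y)) ∂mu
      ≤ ENNReal.ofReal (4 * Real.exp r) *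
        ∫⁻ z in A ×ˢ Set.univ, ENNReal.ofReal (‖z.1 - z.2‖ ^ 2) ∂π := by
  set p := density lam mu π with hp
  have hpm : Measurable p := measurable_density lam mu π
  have hp0 : ∀ z, 0 ≤ p z := density_nonneg lam mu π
  let F : Space d × Space d → ℝ≥0∞ := fun z => ENNReal.ofReal (‖z.1 - z.2‖ ^ 2 * p z)
  have hFm : Measurable F := by
    have : Measurable (fun z : Space d × Space d => ‖z.1 - z.2‖ ^ 2) := by fun_prop
    exact (this.mul hpm).ennreal_ofReal
  have hsec : Measurable fun y => p (x, y) := hpm.comp (by fun_prop)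
  have hpt : ∀ᵐ y ∂mu.restrict S, π (A ×ˢ B) * F (x, y)
      ≤ ENNReal.ofReal (4 * Real.exp r) * ∫⁻ x' in A, F (x', y) ∂lam := by
    filter_upwards [ae_restrict_mem hS, ae_restrict_of_ae hx4] with y hy h4
    have hsec' : Measurable fun x' => F (x', y) := hFm.comp (by fun_prop)
    calc π (A ×ˢ B) * F (x, y)
        = ∫⁻ z in A ×ˢ B, ENNReal.ofReal (p z) * F (x, y) ∂lam.prod mu := by
          rw [lintegral_mul_const _ hpm.ennreal_ofReal, ← withDensity_apply _ (hA.prod hB), hw]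
      _ ≤ ∫⁻ z in A ×ˢ B, ENNReal.ofReal (4 * Real.exp r) *
            (F (z.1, y) * ENNReal.ofReal (p (x, z.2))) ∂lam.prod mu := by
          refine lintegral_mono_ae ?_
          filter_upwards [ae_restrict_mem (hA.prod hB), ae_restrict_of_ae h4] with z hz hz4
          obtain ⟨g1, g2⟩ := hgeo y hy z.1 hz.1 z.2 hz.2
          simp only [F]
          rw [← ENNReal.ofReal_mul (hp0 _),
            ← ENNReal.ofReal_mul (mul_nonneg (sq_nonneg _) (hp0 _)), ← ENNReal.ofReal_mul (by positivity)]
          refine ENNReal.ofReal_le_ofReal ?_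
          have hexp := Real.exp_le_exp.2 g1
          have n1 : 0 ≤ p (x, z.2) * p (z.1, y) := mul_nonneg (hp0 _) (hp0 _)
          calc p z * (‖x - y‖ ^ 2 * p (x, y)) = ‖x - y‖ ^ 2 * (p (x, y) * p z) := by ring
            _ ≤ (4 * ‖z.1 - y‖ ^ 2) * (p (x, z.2) * p (z.1, y) * Real.exp r) :=
                mul_le_mul g2 (hz4.trans (mul_le_mul_of_nonneg_left hexp n1))
                  (mul_nonneg (hp0 _) (hp0 _)) (by positivity)
            _ = _ := by ring
      _ = ENNReal.ofReal (4 * Real.exp r) * ((∫⁻ x' in A, F (x', y) ∂lam) *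
            ∫⁻ y' in B, ENNReal.ofReal (p (x, y')) ∂mu) := by
          rw [lintegral_const_mul' _ _ ENNReal.ofReal_ne_top, ← Measure.prod_restrict,
            lintegral_prod_mul hsec'.aemeasurable hsec.ennreal_ofReal.aemeasurable]
      _ ≤ ENNReal.ofReal (4 * Real.exp r) * ((∫⁻ x' in A, F (x', y) ∂lam) * 1) := by
          gcongr
          exact (setLIntegral_le_lintegral _ _).trans hx1
      _ = _ := by rw [mul_one]
  calc π (A ×ˢ B) * ∫⁻ y in S, F (x, y) ∂mu
      = ∫⁻ y in S, π (A ×ˢ B) * F (x, y) ∂mu :=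
        (lintegral_const_mul' _ _ (measure_ne_top _ _)).symm
    _ ≤ ∫⁻ y in S, ENNReal.ofReal (4 * Real.exp r) * ∫⁻ x' in A, F (x', y) ∂lam ∂mu :=
        lintegral_mono_ae hpt
    _ = ENNReal.ofReal (4 * Real.exp r) * ∫⁻ y in S, ∫⁻ x' in A, F (x', y) ∂lam ∂mu :=
        lintegral_const_mul' _ _ ENNReal.ofReal_ne_top
    -- Enlarging S to the whole space turns the double integral into the transport cost out of A.
    _ ≤ ENNReal.ofReal (4 * Real.exp r) * ∫⁻ y, ∫⁻ x' in A, F (x', y) ∂lam ∂mu := by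
        gcongr
        exact Measure.restrict_le_self
    _ = ENNReal.ofReal (4 * Real.exp r) * ∫⁻ z in A ×ˢ Set.univ, F z ∂lam.prod mu := by
        rw [← Measure.prod_restrict, Measure.restrict_univ, ← lintegral_prod_symm' _ hFm]
    _ = _ := by
        congr 1
        have hc : Measurable fun z : Space d × Space d => ENNReal.ofReal (‖z.1 - z.2‖ ^ 2) := by
          fun_prop
        conv_rhs => rw [← hw]
        rw [setLIntegral_withDensity_eq_setLIntegral_mul _ hpm.ennreal_ofReal hc
          (hA.prod MeasurableSet.univ)]
        refine lintegral_congr fun z => ?_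
        simp only [F, Pi.mul_apply]
        rw [← ENNReal.ofReal_mul (hp0 z), mul_comm]

/-! ### Choice of competitors and the mass they carry. -/

/-- Relative to x, the cost change is -2⟨x' - x, y - x⟩ + 2⟨x' - x, y' - x⟩. The radius R/(4κ) lets
the deviation of x' consume only half of the gain along e, leaving R|y - x|/(4κ) ≥ 5R²/2. The second
inner product is at most 2R², so the total is at most -5R² + 4R² = -R²; this is where the factor 10
comes from. -/
lemma four_point_geometry {d : ℕ} {κ R ε : ℝ} (hκ : 1 ≤ κ) (hR : 0 < R) (hε : 0 < ε)
    {x e y x' y' : Space d} (he : ‖e‖ = 1)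
    (hy : 10 * κ * R ≤ ‖x - y‖) (hye : ‖x - y‖ ≤ κ * inner ℝ e (y - x))
    (hx' : x' ∈ ball (x + (R / 2) • e) (R / (4 * κ))) (hy' : y' ∈ ball (x + (R / 2) • e) R) :
    (‖x - y'‖ ^ 2 + ‖x' - y‖ ^ 2 - ‖x - y‖ ^ 2 - ‖x' - y'‖ ^ 2) / ε ^ 2 ≤ -(R ^ 2 / ε ^ 2) ∧
      ‖x - y‖ ^ 2 ≤ 4 * ‖x' - y‖ ^ 2 := by
  have hκ0 : 0 < κ := by linarith
  rw [mem_ball, dist_eq_norm] at hx' hy'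
  obtain ⟨a, rfl⟩ : ∃ a, x' = x + (R / 2) • e + a := ⟨x' - (x + (R / 2) • e), by abel⟩
  obtain ⟨b, rfl⟩ : ∃ b, y' = x + (R / 2) • e + b := ⟨y' - (x + (R / 2) • e), by abel⟩
  obtain ⟨z, rfl⟩ : ∃ z, y = x + z := ⟨y - x, by abel⟩
  rw [add_sub_cancel_left] at hx' hy' hye
  have hz : ‖x - (x + z)‖ = ‖z‖ := by rw [sub_add_cancel_left, norm_neg]
  have hne : ‖(R / 2) • e‖ = R / 2 := by
    rw [norm_smul, he, mul_one, Real.norm_of_nonneg (by positivity)]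
  have hηR : R / (4 * κ) ≤ R / 4 := by
    rw [div_le_div_iff₀ (by positivity) (by norm_num)]; nlinarith
  rw [hz] at hy hye ⊢
  set f := (R / 2) • e with hf
  have hu : ‖f + a‖ ≤ R := (norm_add_le _ _).trans (by linarith)
  have hv : ‖f + b‖ ≤ 2 * R := (norm_add_le _ _).trans (by linarith)
  have hid : ‖x - (x + f + b)‖ ^ 2 + ‖x + f + a - (x + z)‖ ^ 2 - ‖z‖ ^ 2
      - ‖x + f + a - (x + f + b)‖ ^ 2
      = -2 * inner ℝ (f + a) z + 2 * inner ℝ (f + a) (f + b) := by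
    have e1 : x - (x + f + b) = -(f + b) := by abel
    have e2 : x + f + a - (x + z) = (f + a) - z := by abel
    have e3 : x + f + a - (x + f + b) = (f + a) - (f + b) := by abel
    rw [e1, e2, e3, norm_neg, norm_sub_sq_real, norm_sub_sq_real]
    ring
  have hiz : R * ‖z‖ / (4 * κ) ≤ inner ℝ (f + a) z := by
    rw [inner_add_left, hf, real_inner_smul_left]
    have h1 : -(‖a‖ * ‖z‖) ≤ inner ℝ a z := (abs_le.1 (abs_real_inner_le_norm a z)).1
    have h2 : ‖a‖ * ‖z‖ ≤ R / (4 * κ) * ‖z‖ :=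
      mul_le_mul_of_nonneg_right hx'.le (norm_nonneg _)
    have h3 : ‖z‖ / κ ≤ inner ℝ e z := by rwa [div_le_iff₀' hκ0]
    have h4 : R / 2 * (‖z‖ / κ) ≤ R / 2 * inner ℝ e z :=
      mul_le_mul_of_nonneg_left h3 (by positivity)
    have h5 : R / 2 * (‖z‖ / κ) - R / (4 * κ) * ‖z‖ = R * ‖z‖ / (4 * κ) := by
      field_simp; ring
    linarith
  have hiv : inner ℝ (f + a) (f + b) ≤ 2 * R ^ 2 := by
    refine (real_inner_le_norm _ _).trans ?_
    nlinarith [norm_nonneg (f + a), norm_nonneg (f + b)]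
  have hbig : 10 * R ^ 2 / 4 ≤ R * ‖z‖ / (4 * κ) := by
    rw [div_le_div_iff₀ (by norm_num) (by positivity)]
    nlinarith
  refine ⟨?_, ?_⟩
  · rw [hid, ← neg_div]
    gcongr
    linarith
  · have h1 : ‖z‖ ≤ ‖f + a‖ + ‖x + f + a - (x + z)‖ := by
      have : z = (f + a) - (x + f + a - (x + z)) := by abel
      conv_lhs => rw [this]
      exact norm_sub_le _ _
    have h2 : 10 * R ≤ ‖z‖ := by nlinarith
    nlinarith [norm_nonneg z]

/-- Mass leaving the larger ball travels at least R/2, so by Chebyshev it amounts to at most m, half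
of the available 2m. -/
lemma ofReal_le_measure_prod_ball {d : ℕ} {lam : Measure (Space d)}
    {π : Measure (Space d × Space d)} (h1 : π.map Prod.fst = lam) {a : Space d} {r R m : ℝ}
    (hR : 0 < R) (hr : r ≤ R / 2) (hm0 : 0 ≤ m)
    (hm : ENNReal.ofReal (2 * m) ≤ lam (ball a r))
    (hJ : ∫⁻ z in ball a r ×ˢ Set.univ, ENNReal.ofReal (‖z.1 - z.2‖ ^ 2) ∂π
      ≤ ENNReal.ofReal ((R / 2) ^ 2 * m)) :
    ENNReal.ofReal m ≤ π (ball a r ×ˢ ball a R) := by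
  have hfar : π (ball a r ×ˢ (ball a R)ᶜ) ≤ ENNReal.ofReal m := by
    have hmeas : MeasurableSet (ball a r ×ˢ (ball a R)ᶜ) :=
      measurableSet_ball.prod measurableSet_ball.compl
    have hpos : 0 < (R / 2) ^ 2 := by positivity
    have h2 : ENNReal.ofReal ((R / 2) ^ 2) * π (ball a r ×ˢ (ball a R)ᶜ)
        ≤ ENNReal.ofReal ((R / 2) ^ 2) * ENNReal.ofReal m := by
      rw [← ENNReal.ofReal_mul hpos.le]
      refine le_trans ?_ hJ
      rw [← setLIntegral_const]
      refine (setLIntegral_mono' hmeas ?_).trans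
        (lintegral_mono_set (Set.prod_mono_right (Set.subset_univ _)))
      rintro ⟨u, v⟩ ⟨hu, hv⟩
      refine ENNReal.ofReal_le_ofReal ?_
      simp only [Set.mem_compl_iff, mem_ball, not_lt] at hu hv
      have := dist_triangle_left v a u
      rw [← dist_eq_norm]
      gcongr
      linarith
    exact (ENNReal.mul_le_mul_iff_right (ENNReal.ofReal_pos.2 hpos).ne' ENNReal.ofReal_ne_top).1 h2
  have hsplit : lam (ball a r) ≤ π (ball a r ×ˢ ball a R) + π (ball a r ×ˢ (ball a R)ᶜ) := by
    rw [← h1, Measure.map_apply measurable_fst measurableSet_ball]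
    refine le_trans (measure_mono ?_) (measure_union_le _ _)
    rintro ⟨u, v⟩ hu
    by_cases hv : v ∈ ball a R
    · exact Or.inl ⟨hu, hv⟩
    · exact Or.inr ⟨hu, hv⟩
  rw [two_mul, ENNReal.ofReal_add hm0 hm0] at hm
  exact ENNReal.le_of_add_le_add_right ENNReal.ofReal_ne_top
    (hm.trans (hsplit.trans (add_le_add le_rfl hfar)))

/-- The norm is at most the sum of the absolute coordinates, so they cannot all be below |z|/(d+1).
-/
lemma exists_norm_le_mul_abs {d : ℕ} {z : Space d} (hz : 0 < ‖z‖) :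
    ∃ i, ‖z‖ ≤ (d + 1) * |z i| := by
  by_contra! h
  have hsum : ‖z‖ ≤ ∑ i, |z i| := by
    conv_lhs => rw [← (EuclideanSpace.basisFun (Fin d) ℝ).sum_repr z]
    refine (norm_sum_le _ _).trans (Finset.sum_le_sum fun i _ => ?_)
    simp [norm_smul]
  have h2 : ((d : ℝ) + 1) * ‖z‖ ≤ d * ‖z‖ := by
    calc ((d : ℝ) + 1) * ‖z‖ ≤ (d + 1) * ∑ i, |z i| := by gcongr
      _ = ∑ i, (d + 1) * |z i| := Finset.mul_sum _ _ _
      _ ≤ ∑ _i : Fin d, ‖z‖ := Finset.sum_le_sum fun i _ => (h i).le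
      _ = d * ‖z‖ := by simp
  nlinarith

/-- The signed coordinate directions. -/
noncomputable def direction {d : ℕ} (k : Fin d × Bool) : Space d :=
  (if k.2 then (1 : ℝ) else -1) • EuclideanSpace.single k.1 1

lemma norm_direction {d : ℕ} (k : Fin d × Bool) : ‖direction k‖ = 1 := by
  unfold direction
  split_ifs <;> simp

lemma exists_direction {d : ℕ} {z : Space d} (hz : 0 < ‖z‖) :
    ∃ k : Fin d × Bool, ‖z‖ ≤ (d + 1) * inner ℝ (direction k) z := by
  obtain ⟨i, hi⟩ := exists_norm_le_mul_abs hz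
  rcases le_total 0 (z i) with h | h
  · refine ⟨(i, true), ?_⟩
    rw [abs_of_nonneg h] at hi
    simpa [direction, real_inner_smul_left, EuclideanSpace.inner_single_left] using hi
  · refine ⟨(i, false), ?_⟩
    rw [abs_of_nonpos h] at hi
    simpa [direction, real_inner_smul_left, EuclideanSpace.inner_single_left] using hi

/-! ### The tail bound at a point. -/

lemma lintegral_excess {d : ℕ} {π : Measure (Space d × Space d)} {R : ℝ} (hR : 0 < R)
    (hc : Integrable (fun z : Space d × Space d => ‖z.1 - z.2‖ ^ 2) π) :
    ∫⁻ z in ball (0 : Space d) R ×ˢ Set.univ, ENNReal.ofReal (‖z.1 - z.2‖ ^ 2) ∂π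
      = ENNReal.ofReal (R ^ (d + 2) * excess π R) := by
  rw [excess, mul_inv_cancel_left₀ (by positivity),
    ofReal_integral_eq_lintegral_ofReal hc.integrableOn (ae_of_all _ fun z => by positivity)]

lemma excess_nonneg {d : ℕ} {π : Measure (Space d × Space d)} {R : ℝ} (hR : 0 < R) :
    0 ≤ excess π R :=
  mul_nonneg (by positivity) (integral_nonneg fun z => by positivity)

lemma rpow_mul_holderSeminorm_le {d : ℕ} {α : ℝ≥0} {R b : ℝ} {ρ σ : Space d → ℝ}
    (hR : 0 < R) (hb : 0 ≤ b) (h : dataTerm α R ρ σ ≤ b ^ 2) :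
    R ^ (α : ℝ) * holderSeminorm α R ρ ≤ b := by
  refine abs_le_of_sq_le_sq' ?_ hb |>.2
  refine le_trans ?_ h
  unfold dataTerm
  have : R ^ (2 * (α : ℝ)) = (R ^ (α : ℝ)) ^ 2 := by
    rw [mul_comm, Real.rpow_mul hR.le]; norm_num
  rw [mul_pow, this]
  gcongr
  exact le_add_of_nonneg_right (sq_nonneg _)

/-- The tail estimate at a point `x` at which the integrated four point inequality and the
marginal bound are available. -/
lemma tail_lintegral_le {d : ℕ} {lam mu : Measure (Space d)}
    [IsFiniteMeasure lam] [IsFiniteMeasure mu] {π : Measure (Space d × Space d)}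
    [IsFiniteMeasure π] (h1 : π.map Prod.fst = lam) (hw : (lam.prod mu).withDensity
      (fun z => ENNReal.ofReal (density lam mu π z)) = π)
    {ε R m I : ℝ} (hε : 0 < ε) (hR : 0 < R) (hm : 0 < m) {x : Space d}
    (hxR : x ∈ ball (0 : Space d) R)
    (hx1 : ∫⁻ y, ENNReal.ofReal (density lam mu π (x, y)) ∂mu ≤ 1)
    (hx4 : ∀ᵐ y ∂mu, ∀ᵐ z ∂lam.prod mu, density lam mu π (x, y) * density lam mu π z ≤
        density lam mu π (x, z.2) * density lam mu π (z.1, y) *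
        Real.exp ((‖x - z.2‖ ^ 2 + ‖z.1 - y‖ ^ 2 - ‖x - y‖ ^ 2 - ‖z.1 - z.2‖ ^ 2) / ε ^ 2))
    (hmass : ∀ a : Space d, ball a (R / (4 * (d + 1))) ⊆ ball 0 (2 * R) →
      ENNReal.ofReal (2 * m) ≤ lam (ball a (R / (4 * (d + 1)))))
    (hI : ∫⁻ z in ball (0 : Space d) (2 * R) ×ˢ Set.univ, ENNReal.ofReal (‖z.1 - z.2‖ ^ 2) ∂π
      ≤ ENNReal.ofReal I)
    (hIm : I ≤ (R / 2) ^ 2 * m) :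
    ∫⁻ y in {y | 10 * (d + 1) * R ≤ ‖x - y‖},
        ENNReal.ofReal (‖x - y‖ ^ 2 * density lam mu π (x, y)) ∂mu
      ≤ ENNReal.ofReal (2 * d * (4 * Real.exp (-(R ^ 2 / ε ^ 2)) * I / m)) := by
  set κ : ℝ := d + 1 with hκ
  have hκ1 : 1 ≤ κ := by simp [hκ]
  have hηR : R / (4 * κ) ≤ R / 4 := by
    rw [div_le_div_iff₀ (by positivity) (by norm_num)]; nlinarith
  let S : Fin d × Bool → Set (Space d) := fun k =>
    {y | 10 * κ * R ≤ ‖x - y‖ ∧ ‖x - y‖ ≤ κ * inner ℝ (direction k) (y - x)}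
  have hn : Measurable fun y => ‖x - y‖ := by fun_prop
  have hin : ∀ k : Fin d × Bool, Measurable fun y => κ * inner ℝ (direction k) (y - x) :=
    fun k => by fun_prop
  have hSm : ∀ k, MeasurableSet (S k) := fun k =>
    (measurableSet_le measurable_const hn).inter (measurableSet_le hn (hin k))
  have hsec : ∀ k, ∫⁻ y in S k, ENNReal.ofReal (‖x - y‖ ^ 2 * density lam mu π (x, y)) ∂mu
      ≤ ENNReal.ofReal (4 * Real.exp (-(R ^ 2 / ε ^ 2)) * I / m) := by
    intro k
    have hsub : ball (x + (R / 2) • direction k) (R / (4 * κ)) ⊆ ball 0 (2 * R) := by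
      refine ball_subset_ball' ?_
      have : dist (x + (R / 2) • direction k) 0 ≤ ‖x‖ + R / 2 := by
        rw [dist_zero_right]
        refine (norm_add_le _ _).trans ?_
        rw [norm_smul, norm_direction, mul_one, Real.norm_of_nonneg (by positivity)]
      have := mem_ball_zero_iff.1 hxR
      linarith
    have hJ := (lintegral_mono_set (μ := π)
      (f := fun z : Space d × Space d => ENNReal.ofReal (‖z.1 - z.2‖ ^ 2))
      (Set.prod_mono_left (t := Set.univ) hsub)).trans hI
    have hmk := ofReal_le_measure_prod_ball h1 (R := R) hR (by linarith) hm.le (hmass _ hsub)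
      (hJ.trans (ENNReal.ofReal_le_ofReal hIm))
    have key := measure_mul_lintegral_le hw hx1 hx4 (measurableSet_ball) (measurableSet_ball)
      (hSm k) (r := -(R ^ 2 / ε ^ 2)) fun y hy x' hx' y' hy' =>
        four_point_geometry hκ1 hR hε (norm_direction k) hy.1 hy.2 hx' hy'
    rw [ENNReal.ofReal_div_of_pos hm, ENNReal.le_div_iff_mul_le
      (Or.inl (by simpa using hm)) (Or.inl ENNReal.ofReal_ne_top),
      ENNReal.ofReal_mul (by positivity), mul_comm]
    exact (mul_le_mul_left hmk _).trans (key.trans (mul_le_mul_right hJ _))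
  -- Finitely many cones, one per signed coordinate direction, cover all far targets; their number
  -- 2d enters the constant.
  have hcover : {y : Space d | 10 * κ * R ≤ ‖x - y‖} ⊆ ⋃ k, S k := by
    intro y hy
    have hyx : ‖y - x‖ = ‖x - y‖ := norm_sub_rev _ _
    have hpos : 0 < ‖y - x‖ := by
      rw [hyx]
      exact lt_of_lt_of_le (by positivity) hy
    obtain ⟨k, hk⟩ := exists_direction hpos
    exact Set.mem_iUnion.2 ⟨k, hy, hyx ▸ hk⟩
  refine (lintegral_mono_set hcover).trans ((lintegral_iUnion_le _ _).trans ?_)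
  rw [tsum_fintype]
  refine (Finset.sum_le_sum fun k _ => hsec k).trans ?_
  rw [ENNReal.ofReal_mul (by positivity), Finset.sum_const, Finset.card_univ,
    Fintype.card_prod, Fintype.card_fin, Fintype.card_bool, nsmul_eq_mul]
  refine mul_le_mul_left (le_of_eq ?_) _
  rw [mul_comm (2 : ℝ), ENNReal.ofReal_mul (by positivity), ENNReal.ofReal_natCast]
  simp

end ROT

/-! ### Constants and conclusion. -/

theorem proposition3p1 (d : ℕ) :
    ∃ C Λ K : ℝ, 0 < C ∧ 0 < Λ ∧ 0 < K ∧ ∀ c : ℝ, 0 < c → ∃ δ : ℝ, 0 < δ ∧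
      ∀ (α : ℝ≥0) (ε R : ℝ) (lam mu : Measure (ROT.Space d)) (ρ σ : ROT.Space d → ℝ)
        (π : Measure (ROT.Space d × ROT.Space d)),
        0 < α → α ≤ 1 → 0 < ε → ε ≤ 1 →
        IsFiniteMeasure lam → IsFiniteMeasure mu → lam ≪ volume → mu ≪ volume →
        ROT.IsMinimiser ROT.entropy ε lam mu π →
        C * ε ≤ R →
        ROT.HasHolderDensityOn α (2 * R) lam ρ → ROT.HasHolderDensityOn α (2 * R) mu σ →
        (∀ x ∈ ball (0 : ROT.Space d) R, c ≤ ρ x ∧ c ≤ σ x) →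
        ROT.excess π (2 * R) + ROT.dataTerm α (2 * R) ρ σ ≤ δ →
        ∀ᵐ x ∂(volume.restrict (ball (0 : ROT.Space d) R)),
          IntegrableOn (fun y => ‖x - y‖ ^ 2 * ROT.density lam mu π (x, y))
            {y | Λ * R ≤ ‖x - y‖} mu ∧
          1 / R ^ 2 * ∫ y in {y | Λ * R ≤ ‖x - y‖},
              ‖x - y‖ ^ 2 * ROT.density lam mu π (x, y) ∂mu
            ≤ K * Real.exp (-(R ^ 2 / ε ^ 2)) * (1 + ROT.excess π (2 * R)) := by
  open ROT in
  set ω : ℝ := (volume (ball (0 : Space d) 1)).toReal with hω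
  have hω0 : 0 < ω := ENNReal.toReal_pos (measure_ball_pos _ _ one_pos).ne' measure_ball_lt_top.ne
  -- Chosen so that 2c m₀ R^d is exactly c/2 times the volume of a ball of radius R/(4(d+1)).
  set m₀ : ℝ := ω / (4 * (4 * (d + 1)) ^ d) with hm₀
  have hm₀0 : 0 < m₀ := by positivity
  -- The three entries of δ give, in turn, oscillation at most c/2, the bound E ≤ c that frees K of
  -- c, and excess small enough for the Chebyshev step. The final +1 in K keeps it positive when d =
  -- 0.
  refine ⟨1, 10 * (d + 1), 2 * d * 2 ^ (d + 4) / m₀ + 1, one_pos, by positivity, by positivity,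
    fun c hc => ⟨min ((c / 2) ^ 2) (min c (c * m₀ / 2 ^ (d + 4))), by positivity, ?_⟩⟩
  intro α ε R lam mu ρ σ π hα hα1 hε hε1 _ _ hlam hmu hπ hCR hρ hσ hcρσ hδ
  have hR : 0 < R := by linarith
  obtain ⟨⟨hπ1, hπ2⟩, hπac, hπc, hπh⟩ := hπ.admissible
  have : IsFiniteMeasure π := by
    refine ⟨?_⟩
    have h := congrArg (fun m => m Set.univ) hπ1
    simp only [Measure.map_apply measurable_fst MeasurableSet.univ, Set.preimage_univ] at h
    rw [h]
    exact measure_lt_top _ _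
  set E := excess π (2 * R) with hE
  have hE0 : 0 ≤ E := excess_nonneg (by positivity)
  have hD0 : 0 ≤ dataTerm α (2 * R) ρ σ := by unfold dataTerm; positivity
  have hD : dataTerm α (2 * R) ρ σ ≤ (c / 2) ^ 2 :=
    (le_trans (by linarith) hδ).trans (min_le_left _ _)
  have hEc : E ≤ c :=
    (le_trans (by linarith) hδ).trans ((min_le_right _ _).trans (min_le_left _ _))
  have hEm : E ≤ c * m₀ / 2 ^ (d + 4) :=
    (le_trans (by linarith) hδ).trans ((min_le_right _ _).trans (min_le_right _ _))
  have hlow := smul_volume_restrict_le hR hρ (fun x hx => (hcρσ x hx).1)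
    (rpow_mul_holderSeminorm_le (by positivity) (by positivity) hD)
  have hw := withDensity_toReal_rnDeriv hπac
  have hae : ∀ᵐ x ∂lam, (∫⁻ y, ENNReal.ofReal (density lam mu π (x, y)) ∂mu ≤ 1) ∧
      ∀ᵐ y ∂mu, ∀ᵐ z ∂lam.prod mu, density lam mu π (x, y) * density lam mu π z ≤
        density lam mu π (x, z.2) * density lam mu π (z.1, y) *
        Real.exp ((‖x - z.2‖ ^ 2 + ‖z.1 - y‖ ^ 2 - ‖x - y‖ ^ 2 - ‖z.1 - z.2‖ ^ 2) / ε ^ 2) :=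
    (lintegral_density_le_one hπ1 hw).and
      (Measure.ae_ae_of_ae_prod (Measure.ae_ae_of_ae_prod (four_point hε hπ)))
  -- The lower density bound transfers λ-almost everywhere statements to Lebesgue-almost every point
  -- of B_R.
  have hac : volume.restrict (ball (0 : Space d) R) ≪ lam := by
    have h1 : volume.restrict (ball (0 : Space d) (2 * R)) ≪ lam :=
      (Measure.absolutelyContinuous_smul (c := ENNReal.ofReal (c / 2)) (by simpa using hc)).trans
        (Measure.absolutelyContinuous_of_le hlow)
    exact (Measure.absolutelyContinuous_of_le
      (Measure.restrict_mono_set _ (ball_subset_ball (by linarith)))).trans h1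
  filter_upwards [hac.ae_le hae, ae_restrict_mem measurableSet_ball] with x hx hxR
  have hmass : ∀ a : Space d, ball a (R / (4 * (d + 1))) ⊆ ball 0 (2 * R) →
      ENNReal.ofReal (2 * (c * m₀ * R ^ d)) ≤ lam (ball a (R / (4 * (d + 1)))) := by
    intro a ha
    refine le_trans (le_of_eq ?_) (hlow _)
    rw [Measure.smul_apply, Measure.restrict_apply measurableSet_ball,
      Set.inter_eq_self_of_subset_left ha,
      Measure.addHaar_ball_of_pos _ _ (by positivity : 0 < R / (4 * ((d : ℝ) + 1))),
      ← ENNReal.ofReal_toReal (measure_ball_lt_top (μ := volume) (x := (0 : Space d))).ne,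
      ← hω, smul_eq_mul, ← ENNReal.ofReal_mul (by positivity), ← ENNReal.ofReal_mul (by positivity),
      finrank_euclideanSpace_fin]
    congr 1
    rw [hm₀, div_pow]
    field_simp
    ring
  have htail := tail_lintegral_le hπ1 hw hε hR (m := c * m₀ * R ^ d) (by positivity)
    (I := (2 * R) ^ (d + 2) * E) hxR hx.1 hx.2 hmass
    (lintegral_excess (by positivity) hπc).le (by
      rw [le_div_iff₀ (by positivity)] at hEm
      calc (2 * R) ^ (d + 2) * E = R ^ (d + 2) / 4 * (E * 2 ^ (d + 4)) := by ring
        _ ≤ R ^ (d + 2) / 4 * (c * m₀) := by gcongr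
        _ = _ := by ring)
  have hmeas : Measurable fun y => ‖x - y‖ ^ 2 * density lam mu π (x, y) :=
    Measurable.mul (by fun_prop) ((measurable_density lam mu π).comp (by fun_prop))
  have hnn : ∀ y, 0 ≤ ‖x - y‖ ^ 2 * density lam mu π (x, y) := fun y =>
    mul_nonneg (by positivity) (density_nonneg _ _ _ _)
  refine ⟨⟨hmeas.aestronglyMeasurable, ?_⟩, ?_⟩
  · rw [hasFiniteIntegral_iff_ofReal (ae_of_all _ hnn)]
    exact htail.trans_lt ENNReal.ofReal_lt_top
  · rw [integral_eq_lintegral_of_nonneg_ae (ae_of_all _ hnn) hmeas.aestronglyMeasurable]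
    have h2 := ENNReal.toReal_le_of_le_ofReal (by positivity) htail
    calc _ ≤ 1 / R ^ 2 * (2 * d * (4 * Real.exp (-(R ^ 2 / ε ^ 2)) * ((2 * R) ^ (d + 2) * E)
            / (c * m₀ * R ^ d))) := by gcongr
      _ = 2 * d * 2 ^ (d + 4) / m₀ * Real.exp (-(R ^ 2 / ε ^ 2)) * (E / c) := by
          field_simp
          ring
      -- Since E ≤ c, the factor E/c is at most 1, which removes the dependence on c.
      _ ≤ (2 * d * 2 ^ (d + 4) / m₀ + 1) * Real.exp (-(R ^ 2 / ε ^ 2)) * (1 + E) := by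
          gcongr
          · linarith
          · rw [div_le_iff₀ hc]
            nlinarith
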